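/- For a real sequence $(a_n)$ write $\sum_{n\ge 0}' a_n=\tfrac12 a_0+\sum_{n\ge 1}a_n$. Let $W(0)=\tfrac12$ and $W(n)=e^{-n}$ for integers $n\ge 1$, and consider the discrete measure $\sum_{n\ge0}W(n)\,\delta_n$ with its inner product $\langle f,g\rangle'=\sum_{n\ge0}' e^{-n}f(n)g(n)$ (the case $h=s=1$, $\tau=e$). The modified discrete Laguerre (MDL) polynomials $L_n'$ are obtained by Gram--Schmidt orthogonalization with respect to $\langle\cdot,\cdot\rangle'$ of the discrete Laguerre polynomials $$L_n(x)=\sum_{i=0}^n(-1)^i\binom ni\frac{(1-1/e)^i}{i!}\prod_{j=1}^i(x+j).$$ For $N\ge 0$ let $x_0^{(N)}<\dots<x_{N-1}^{(N)}$ be the roots of $L_N'$, and let $w_k^{(N)}=\sum_{n\ge0}W(n)\,\ell_k^{(N)}(n)$, where $\ell_k^{(N)}$ is the Lagrange basis polynomial of degree $N-1$ with $\ell_k^{(N)}(x_j^{(N)})=\delta_{jk}$. Then: (1) For every $N$, $L_N'$ has degree $N$ and $N$ distinct real roots, all positive; all weights $w_k^{(N)}$ are positive; and $\sum_{k=0}^{N-1}w_k^{(N)}p(x_k^{(N)})=\sum_{n\ge0}W(n)p(n)$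 for every real polynomial $p$ of degree at most $2N-1$. (2) For every integer $m\ge 0$ the even moment $c_{2m}=\sum_{n\ge 0}W(n)\,n^{2m}$ (with $0^0=1$) is finite and satisfies $c_{2m}<2\,(2m)!$. (3) For every fixed $k\ge0$, $x_k^{(N)}\to k$ and $w_k^{(N)}\to W(k)$ as $N\to\infty$. (4) Let $F$ be a real-valued function that is right-continuous at every nonnegative integer (for example, continuous on $[0,\infty)$) and satisfies $|F(x)|=O(x^{-1-\epsilon})$ as $x\to\infty$ for some $\epsilon>0$. Then $\sum_n F(n)$ converges absolutely and the $N$-point MDL Gaussian summation rule converges to the primed sum: $$\lim_{N\to\infty}\sum_{k=0}^{N-1}w_k^{(N)}e^{x_k^{(N)}}F\bigl(x_k^{(N)}\bigr)=\sum_{n\ge0}{}' F(n).$$ -/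

import Mathlib

open Filter Topology Asymptotics

namespace MDL

/-- The primed sum `∑' a n = a 0 / 2 + a 1 + a 2 + ⋯`: the term `n = 0` is weighted by `1/2`. -/
noncomputable def primedSum (a : ℕ → ℝ) : ℝ :=
  a 0 / 2 + ∑' n : ℕ, a (n + 1)

/-- The discrete inner product `⟨f, g⟩' = ∑' τ⁻ⁿ f(n) g(n)` (primed sum). -/
noncomputable def inner' (τ : ℝ) (f g : Polynomial ℝ) : ℝ :=
  primedSum fun n => τ⁻¹ ^ n * (f.eval (n : ℝ) * g.eval (n : ℝ))

/-- The discrete Laguerre polynomials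
`L_k(x) = ∑_{i ≤ k} (-1)^i (k choose i) (1 - 1/τ)^i / i! * (x + 1)(x + 2)⋯(x + i)`. -/
noncomputable def dlPoly (τ : ℝ) (k : ℕ) : Polynomial ℝ :=
  ∑ i ∈ Finset.range (k + 1),
    Polynomial.C ((-1) ^ i * (k.choose i : ℝ) * (1 - 1 / τ) ^ i / (i.factorial : ℝ)) *
      ∏ j ∈ Finset.range i, (Polynomial.X + Polynomial.C ((j : ℝ) + 1))

/-- The modified discrete Laguerre polynomials `L'_n`: the Gram-Schmidt orthogonalization of the
discrete Laguerre polynomials with respect to `⟨·, ·⟩'`. -/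
noncomputable def mdlPoly (τ : ℝ) (n : ℕ) : Polynomial ℝ :=
  dlPoly τ n - ∑ i : Fin n,
    Polynomial.C (inner' τ (dlPoly τ n) (mdlPoly τ i) /
      inner' τ (mdlPoly τ i) (mdlPoly τ i)) * mdlPoly τ i
termination_by n
decreasing_by all_goals exact i.isLt

/-- The quadrature node `x_k` (`k = 0, …, N - 1`) of the `N`-point rule: the `k`-th smallest
root of `L'_N`. -/
noncomputable def node (τ : ℝ) (N k : ℕ) : ℝ :=
  ((mdlPoly τ N).roots.toFinset.sort (· ≤ ·)).getD k 0

/-- The Gaussian weight of the node `x_k` with respect to the discrete measure `∑' τ⁻ⁿ δ_n`: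
the integral of the Lagrange basis polynomial of that node. -/
noncomputable def weight (τ : ℝ) (N k : ℕ) : ℝ :=
  primedSum fun n =>
    τ⁻¹ ^ n * (Lagrange.basis (Finset.range N) (node τ N) k).eval (n : ℝ)

/-- The masses of the measure for `h = s = 1`: `W(0) = 1/2` and `W(n) = e⁻ⁿ` for `n ≥ 1`. -/
noncomputable def mass (n : ℕ) : ℝ :=
  if n = 0 then 1 / 2 else Real.exp (-(n : ℝ))

/-- The `N`-point rule for `h = s = 1` (so `τ = e`), applied to the summand `F(x) = f(x) e⁻ˣ`:
it is `∑_k w_k f(x_k)`, that is, `∑_k w_k e^{x_k} F(x_k)`. -/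
noncomputable def rule (N : ℕ) (F : ℝ → ℝ) : ℝ :=
  ∑ k ∈ Finset.range N,
    weight (Real.exp 1) N k * (Real.exp (node (Real.exp 1) N k) * F (node (Real.exp 1) N k))

end MDL

/-! Summation against the masses is a functional on polynomials, positive on nonzero polynomials
that are nonnegative at the integers. Orthogonality therefore forbids `mdlPoly` a nonconstant factor
of one sign on the mass points. This makes the roots real, simple and positive, and puts an integer
strictly between consecutive roots, hence `natCast_lt_node`: the node of index `k` lies to the right
of `k`.

Convergence rests on two bounds: the `j`-th moment is below `2 * j!`, and the rule never
overestimates a monomial (`quad_pow_le`). So the rule converges on power series whose coefficients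
satisfy `∑ |a i| * i! < ∞` (`QuadConverges.of_hasSum`). This yields powers of `e^{-x/2}`, then by
Weierstrass continuous functions of `e^{-x/2}`, among them tents that isolate one mass point; the
tents locate the nodes and weights.

For a summand of order `x^{-p}`, `p = 1 + ε`, the growing function `eˣ F` is dominated by a multiple
of `majorant p`, an increasing power series on which the rule converges. The first nodes are treated
individually and the tail by comparison with the majorant. -/

namespace MDL

/-! ### Summability against the masses. -/

open Polynomial in
theorem summable_exp_mul_eval (p : ℝ[X]) :
    Summable fun n : ℕ => Real.exp (-(n : ℝ)) * p.eval (n : ℝ) := by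
  induction p using Polynomial.induction_on' with
  | add p q hp hq => simpa [mul_add] using hp.add hq
  | monomial k a =>
    have h := (Real.summable_pow_mul_exp_neg_nat_mul k one_pos).mul_left a
    refine h.congr fun n => ?_
    simp only [eval_monomial, neg_mul, one_mul]
    ring

theorem mass_pos (n : ℕ) : 0 < mass n := by
  unfold mass
  split_ifs <;> positivity

theorem mass_nonneg (n : ℕ) : 0 ≤ mass n := (mass_pos n).le

theorem mass_succ (n : ℕ) : mass (n + 1) = Real.exp (-((n + 1 : ℕ) : ℝ)) := by
  simp [mass]

theorem mass_le_exp (n : ℕ) : mass n ≤ Real.exp (-(n : ℝ)) := by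
  unfold mass
  split_ifs with h
  · subst h; norm_num
  · exact le_rfl

theorem summable_mass_mul {f : ℕ → ℝ} (h : Summable fun n : ℕ => Real.exp (-(n : ℝ)) * f n) :
    Summable fun n : ℕ => mass n * f n := by
  rw [← summable_nat_add_iff 1] at h ⊢
  simpa only [mass_succ] using h

theorem summable_mass_mul_eval (p : Polynomial ℝ) :
    Summable fun n : ℕ => mass n * p.eval (n : ℝ) :=
  summable_mass_mul (summable_exp_mul_eval p)

theorem summable_mass_mul_pow (k : ℕ) : Summable fun n : ℕ => mass n * (n : ℝ) ^ k := by
  simpa using summable_mass_mul_eval (Polynomial.X ^ k)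

theorem primedSum_exp_one_inv_pow_mul (f : ℕ → ℝ)
    (h : Summable fun n : ℕ => mass n * f n) :
    primedSum (fun n => (Real.exp 1)⁻¹ ^ n * f n) = ∑' n : ℕ, mass n * f n := by
  rw [h.tsum_eq_zero_add, primedSum]
  congr 1
  · simp [mass]; ring
  · refine tsum_congr fun n => ?_
    rw [mass_succ, ← Real.exp_neg, ← Real.exp_nat_mul]
    congr 2
    ring

/-! ### Moments -/

/-- The moments of `∑ e⁻ⁿ δ_n`. -/
noncomputable def expMoment (k : ℕ) : ℝ := ∑' n : ℕ, Real.exp (-(n : ℝ)) * (n : ℝ) ^ k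

theorem summable_exp_mul_pow (k : ℕ) :
    Summable fun n : ℕ => Real.exp (-(n : ℝ)) * (n : ℝ) ^ k := by
  simpa using summable_exp_mul_eval (Polynomial.X ^ k)

/-- Shift `n` to `n + 1`, which costs a factor `e`, and expand `(n + 1)^k`; for `k ≠ 0` the lost
term at `0` vanishes. -/
theorem exp_mul_expMoment {k : ℕ} (hk : k ≠ 0) :
    Real.exp 1 * expMoment k = ∑ j ∈ Finset.range (k + 1), expMoment j * (k.choose j : ℝ) := by
  unfold expMoment
  rw [(summable_exp_mul_pow k).tsum_eq_zero_add]
  simp only [CharP.cast_eq_zero, ne_eq, hk, not_false_eq_true, zero_pow, mul_zero, zero_add]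
  rw [← tsum_mul_left]
  simp_rw [← tsum_mul_right]
  rw [← Summable.tsum_finsetSum fun j _ => (summable_exp_mul_pow j).mul_right _]
  refine tsum_congr fun n => ?_
  rw [← mul_assoc, ← Real.exp_add]
  push_cast
  rw [add_pow, Finset.mul_sum]
  refine Finset.sum_congr rfl fun j _ => ?_
  rw [show (1 : ℝ) + -((n : ℝ) + 1) = -n by ring]
  simp [mul_assoc]

theorem expMoment_zero_lt : expMoment 0 < 2 := by
  have h : expMoment 0 = (1 - Real.exp (-1))⁻¹ := by
    rw [← tsum_geometric_of_lt_one (Real.exp_pos _).le (by simp), expMoment]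
    refine tsum_congr fun n => ?_
    rw [← Real.exp_nat_mul]
    simp
  have h2 : Real.exp (-1) < 1 / 2 := by
    rw [Real.exp_neg, one_div]
    exact inv_strictAnti₀ two_pos (by linarith [Real.exp_one_gt_d9])
  rw [h]
  have : (1 / 2 : ℝ) < 1 - Real.exp (-1) := by linarith
  calc (1 - Real.exp (-1))⁻¹ < (1 / 2)⁻¹ := inv_strictAnti₀ (by norm_num) this
    _ = 2 := by norm_num

theorem sum_inv_factorial_le (k : ℕ) :
    ∑ i ∈ Finset.range k, 1 / ((i + 1).factorial : ℝ) ≤ Real.exp 1 - 1 := by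
  have h := Real.sum_le_exp_of_nonneg (zero_le_one) (k + 1)
  rw [Finset.sum_range_succ'] at h
  simp at h ⊢
  linarith

/-- Isolating `j = k` in the recursion, `(e - 1) M_k = ∑_{j<k} (k choose j) M_j < 2 k! ∑_{i=1}^{k}
1/i! ≤ 2 k! (e - 1)`. -/
theorem expMoment_lt (k : ℕ) : expMoment k < 2 * (k.factorial : ℝ) := by
  induction k using Nat.strong_induction_on with
  | _ k ih =>
    rcases Nat.eq_zero_or_pos k with rfl | hk
    · simpa using expMoment_zero_lt
    have hrec := exp_mul_expMoment hk.ne'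
    rw [Finset.sum_range_succ] at hrec
    simp only [Nat.choose_self, Nat.cast_one, mul_one] at hrec
    have hlt : ∑ j ∈ Finset.range k, expMoment j * (k.choose j : ℝ) <
        ∑ j ∈ Finset.range k, 2 * (k.factorial : ℝ) * (1 / ((k - 1 - j + 1).factorial : ℝ)) := by
      refine Finset.sum_lt_sum_of_nonempty (by simpa using hk.ne') fun j hj => ?_
      have hjk : j < k := Finset.mem_range.1 hj
      have hc : (0 : ℝ) < k.choose j := by exact_mod_cast Nat.choose_pos hjk.le
      have heq : (k.choose j : ℝ) * j.factorial * (k - j).factorial = k.factorial := by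
        exact_mod_cast Nat.choose_mul_factorial_mul_factorial hjk.le
      rw [show k - 1 - j + 1 = k - j by omega]
      have hf : (0 : ℝ) < (k - j).factorial := by positivity
      calc expMoment j * (k.choose j : ℝ) < 2 * (j.factorial : ℝ) * k.choose j :=
            mul_lt_mul_of_pos_right (ih j hjk) hc
        _ = 2 * (k.factorial : ℝ) * (1 / ((k - j).factorial : ℝ)) := by
            rw [← heq]; field_simp
    rw [← Finset.mul_sum, Finset.sum_range_reflect (fun i => 1 / ((i + 1).factorial : ℝ))] at hlt
    have hle := mul_le_mul_of_nonneg_left (sum_inv_factorial_le k)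
      (by positivity : (0 : ℝ) ≤ 2 * (k.factorial : ℝ))
    have he : (0 : ℝ) < Real.exp 1 - 1 := by linarith [Real.exp_one_gt_d9]
    refine lt_of_mul_lt_mul_left ?_ he.le
    linarith

theorem tsum_mass_mul_pow_lt (k : ℕ) :
    ∑' n : ℕ, mass n * (n : ℝ) ^ k < 2 * (k.factorial : ℝ) :=
  ((summable_mass_mul_pow k).tsum_le_tsum
    (fun n => mul_le_mul_of_nonneg_right (mass_le_exp n) (by positivity))
    (summable_exp_mul_pow k)).trans_lt (expMoment_lt k)

/-! ### The functional of the measure on polynomials -/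

open Polynomial

/-- Summation of a polynomial against the masses. -/
noncomputable def massFunctional : ℝ[X] →ₗ[ℝ] ℝ where
  toFun p := ∑' n : ℕ, mass n * p.eval (n : ℝ)
  map_add' p q := by
    rw [← (summable_mass_mul_eval p).tsum_add (summable_mass_mul_eval q)]
    simp [mul_add]
  map_smul' c p := by
    rw [RingHom.id_apply, smul_eq_mul, ← tsum_mul_left]
    refine tsum_congr fun n => ?_
    rw [eval_smul, smul_eq_mul]
    ring

theorem massFunctional_apply (p : ℝ[X]) :
    massFunctional p = ∑' n : ℕ, mass n * p.eval (n : ℝ) := rfl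

theorem massFunctional_C_mul (c : ℝ) (p : ℝ[X]) :
    massFunctional (C c * p) = c * massFunctional p := by
  rw [← smul_eq_C_mul, map_smul, smul_eq_mul]

theorem eq_zero_of_eval_natCast_eq_zero {p : ℝ[X]} (h : ∀ n : ℕ, p.eval (n : ℝ) = 0) : p = 0 :=
  p.eq_zero_of_infinite_isRoot
    ((Set.infinite_range_of_injective Nat.cast_injective).mono (by rintro _ ⟨n, rfl⟩; exact h n))

theorem massFunctional_nonneg {p : ℝ[X]} (hp : ∀ n : ℕ, 0 ≤ p.eval (n : ℝ)) :
    0 ≤ massFunctional p :=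
  tsum_nonneg fun n => mul_nonneg (mass_nonneg n) (hp n)

theorem massFunctional_pos {p : ℝ[X]} (hp : ∀ n : ℕ, 0 ≤ p.eval (n : ℝ)) (h0 : p ≠ 0) :
    0 < massFunctional p := by
  obtain ⟨n, hn⟩ : ∃ n : ℕ, p.eval (n : ℝ) ≠ 0 := by
    by_contra! h
    exact h0 (eq_zero_of_eval_natCast_eq_zero h)
  exact (summable_mass_mul_eval p).tsum_pos (fun n => mul_nonneg (mass_nonneg n) (hp n)) n
    (mul_pos (mass_pos n) ((hp n).lt_of_ne' hn))

theorem inner'_eq (f g : ℝ[X]) : inner' (Real.exp 1) f g = massFunctional (f * g) := by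
  have := primedSum_exp_one_inv_pow_mul (fun n => (f * g).eval (n : ℝ))
    (summable_mass_mul_eval (f * g))
  simpa only [eval_mul, inner', massFunctional_apply] using this

theorem weight_eq (N k : ℕ) : weight (Real.exp 1) N k =
    massFunctional (Lagrange.basis (Finset.range N) (node (Real.exp 1) N) k) :=
  primedSum_exp_one_inv_pow_mul _ (summable_mass_mul_eval _)

/-! ### Degrees and orthogonality -/

theorem natDegree_prod_X_add_C (i : ℕ) :
    (∏ j ∈ Finset.range i, (X + C ((j : ℝ) + 1))).natDegree = i := by
  rw [natDegree_prod_of_monic _ _ fun j _ => monic_X_add_C _]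
  simp only [natDegree_X_add_C, Finset.sum_const, Finset.card_range, smul_eq_mul, mul_one]

theorem degree_dlPoly {τ : ℝ} (h1 : τ ≠ 1) (n : ℕ) :
    (dlPoly τ n).degree = n := by
  have hτ : 1 - 1 / τ ≠ 0 := by
    rw [sub_ne_zero, ne_comm, one_div, Ne, inv_eq_one]
    exact h1
  rw [dlPoly, Finset.sum_range_succ]
  have hlead : (C ((-1) ^ n * (n.choose n : ℝ) * (1 - 1 / τ) ^ n / (n.factorial : ℝ)) *
      ∏ j ∈ Finset.range n, (X + C ((j : ℝ) + 1))).degree = n := by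
    rw [degree_C_mul (div_ne_zero (by simpa using pow_ne_zero n hτ) (by positivity)),
      degree_eq_natDegree (monic_prod_of_monic _ _ fun j _ => monic_X_add_C _).ne_zero,
      natDegree_prod_X_add_C]
  rw [degree_add_eq_right_of_degree_lt, hlead]
  rw [hlead]
  refine (degree_sum_le _ _).trans_lt
    ((Finset.sup_lt_iff (a := (n : WithBot ℕ)) (WithBot.bot_lt_coe n)).2
      fun i hi => ?_)
  rw [← smul_eq_C_mul]
  refine (degree_smul_le _ _).trans_lt ?_
  rw [degree_eq_natDegree (monic_prod_of_monic _ _ fun j _ => monic_X_add_C _).ne_zero,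
    natDegree_prod_X_add_C]
  exact_mod_cast Finset.mem_range.1 hi

theorem exp_one_ne_one : Real.exp 1 ≠ 1 := by
  simp

theorem degree_mdlPoly (n : ℕ) : (mdlPoly (Real.exp 1) n).degree = n := by
  induction n using Nat.strong_induction_on with
  | _ n ih =>
    have hd := degree_dlPoly exp_one_ne_one n
    rw [mdlPoly, degree_sub_eq_left_of_degree_lt, hd]
    rw [hd]
    refine (degree_sum_le _ _).trans_lt
      ((Finset.sup_lt_iff (a := (n : WithBot ℕ)) (WithBot.bot_lt_coe n)).2
      fun i _ => ?_)
    rw [← smul_eq_C_mul]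
    refine (degree_smul_le _ _).trans_lt ?_
    rw [ih i i.isLt]
    exact_mod_cast i.isLt

theorem mdlPoly_ne_zero (n : ℕ) : mdlPoly (Real.exp 1) n ≠ 0 := by
  intro h
  have := degree_mdlPoly n
  simp [h] at this

theorem natDegree_mdlPoly (n : ℕ) : (mdlPoly (Real.exp 1) n).natDegree = n :=
  natDegree_eq_of_degree_eq_some (degree_mdlPoly n)

theorem massFunctional_self_mul_self_pos {p : ℝ[X]} (hp : p ≠ 0) : 0 < massFunctional (p * p) :=
  massFunctional_pos (fun n => by rw [eval_mul]; exact mul_self_nonneg _) (mul_ne_zero hp hp)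

theorem massFunctional_mdlPoly_mul_mdlPoly {m n : ℕ} (hmn : m < n) :
    massFunctional (mdlPoly (Real.exp 1) n * mdlPoly (Real.exp 1) m) = 0 := by
  induction n using Nat.strong_induction_on generalizing m with
  | _ n ih =>
    rw [mdlPoly, sub_mul, map_sub, Finset.sum_mul, map_sum, sub_eq_zero,
      Finset.sum_eq_single (⟨m, hmn⟩ : Fin n)]
    · rw [mul_assoc, massFunctional_C_mul, inner'_eq, inner'_eq,
        div_mul_cancel₀ _ (massFunctional_self_mul_self_pos (mdlPoly_ne_zero m)).ne']
    · intro i _ hi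
      have him : (i : ℕ) ≠ m := fun h => hi (Fin.ext h)
      rw [mul_assoc, massFunctional_C_mul]
      rcases him.lt_or_gt with h | h
      · rw [mul_comm (mdlPoly _ _), ih m hmn h, mul_zero]
      · rw [ih i i.isLt h, mul_zero]
    · simp

/-- The leading term of `q` is removed by a multiple of a lower orthogonal polynomial, by induction
on a degree bound. -/
theorem massFunctional_mdlPoly_mul {n : ℕ} {q : ℝ[X]} (hq : q.degree < n) :
    massFunctional (mdlPoly (Real.exp 1) n * q) = 0 := by
  suffices H : ∀ d ≤ n, ∀ q : ℝ[X], q.degree < d →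
      massFunctional (mdlPoly (Real.exp 1) n * q) = 0 from H n le_rfl q hq
  intro d
  induction d with
  | zero =>
    intro _ q hq
    have : q = 0 := by
      rw [← degree_eq_bot]
      simpa using hq
    simp [this]
  | succ d ih =>
    intro hd q hq
    set P := mdlPoly (Real.exp 1) d with hP
    have hP0 : P.coeff d ≠ 0 := by
      have := leadingCoeff_ne_zero.2 (mdlPoly_ne_zero d)
      rwa [leadingCoeff, natDegree_mdlPoly] at this
    have hlt : (q - C (q.coeff d / P.coeff d) * P).degree < d := by
      rw [degree_lt_iff_coeff_zero]
      intro m hm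
      rw [coeff_sub, coeff_C_mul]
      rcases hm.eq_or_lt with rfl | hm
      · field_simp; ring
      · rw [coeff_eq_zero_of_degree_lt (n := m) (hq.trans_le (by exact_mod_cast hm)),
          coeff_eq_zero_of_degree_lt (p := P) (n := m)
            (by rw [hP, degree_mdlPoly]; exact_mod_cast hm)]
        simp
    have h := ih (by omega) _ hlt
    rw [mul_sub, map_sub, mul_left_comm, massFunctional_C_mul,
      massFunctional_mdlPoly_mul_mdlPoly (by omega : d < n)] at h
    simpa using h

/-- No nonconstant factor of an orthogonal polynomial is nonnegative on the mass points. -/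
theorem not_nonneg_of_mdlPoly_eq_mul {N : ℕ} {f q : ℝ[X]} (h : mdlPoly (Real.exp 1) N = f * q)
    (hf : 0 < f.natDegree) : ¬ ∀ n : ℕ, 0 ≤ f.eval (n : ℝ) := by
  intro hnn
  have hfq : f * q ≠ 0 := h ▸ mdlPoly_ne_zero N
  have hf0 := left_ne_zero_of_mul hfq
  have hq0 := right_ne_zero_of_mul hfq
  have hdeg : q.degree < N := by
    have h1 := natDegree_mdlPoly N
    rw [h, natDegree_mul hf0 hq0] at h1
    rw [degree_eq_natDegree hq0]
    exact_mod_cast (by omega : q.natDegree < N)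
  -- Testing against the cofactor `q` makes the sum of `f * q²` vanish, although `f * q²` is
  -- nonnegative on the mass points.
  have h0 := massFunctional_mdlPoly_mul hdeg
  rw [h, mul_assoc] at h0
  refine (massFunctional_pos (p := f * (q * q)) (fun n => ?_)
    (mul_ne_zero hf0 (mul_ne_zero hq0 hq0))).ne' h0
  rw [eval_mul, eval_mul]
  exact mul_nonneg (hnn n) (mul_self_nonneg _)

theorem not_nonpos_of_mdlPoly_eq_mul {N : ℕ} {f q : ℝ[X]} (h : mdlPoly (Real.exp 1) N = f * q)
    (hf : 0 < f.natDegree) : ¬ ∀ n : ℕ, f.eval (n : ℝ) ≤ 0 := fun hnp =>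
  not_nonneg_of_mdlPoly_eq_mul (f := -f) (q := -q) (by rw [h]; ring) (by simpa using hf)
    fun n => by simpa using hnp n

theorem eval_nonneg_or_nonpos_of_forall_ne_zero {f : ℝ[X]} (h : ∀ x, f.eval x ≠ 0) :
    (∀ x, 0 ≤ f.eval x) ∨ ∀ x, f.eval x ≤ 0 := by
  by_contra! hc
  obtain ⟨⟨a, ha⟩, b, hb⟩ := hc
  obtain ⟨c, hc⟩ := mem_range_of_exists_le_of_exists_ge f.continuous ⟨a, ha.le⟩ ⟨b, hb.le⟩
  exact h c hc

/-- A nonconstant cofactor left after splitting off all real roots would have constant sign. -/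
theorem card_roots_mdlPoly (N : ℕ) : (mdlPoly (Real.exp 1) N).roots.card = N := by
  obtain ⟨q, hq, hcard, hroots⟩ := exists_prod_multiset_X_sub_C_mul (mdlPoly (Real.exp 1) N)
  rw [natDegree_mdlPoly] at hcard
  by_contra hne
  have hdeg : 0 < q.natDegree := by omega
  have hq0 : q ≠ 0 := fun h => by simp [h] at hdeg
  have hroot : ∀ x, q.eval x ≠ 0 := fun x hx => by
    simpa [hroots] using (mem_roots hq0).2 hx
  rw [mul_comm] at hq
  rcases eval_nonneg_or_nonpos_of_forall_ne_zero hroot with h | h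
  · exact not_nonneg_of_mdlPoly_eq_mul hq.symm hdeg fun n => h n
  · exact not_nonpos_of_mdlPoly_eq_mul hq.symm hdeg fun n => h n

theorem root_mdlPoly_pos {N : ℕ} {a : ℝ} (h : (mdlPoly (Real.exp 1) N).IsRoot a) : 0 < a := by
  obtain ⟨q, hq⟩ := dvd_iff_isRoot.2 h
  by_contra! ha
  refine not_nonneg_of_mdlPoly_eq_mul hq (by simp) fun n => ?_
  have : (0 : ℝ) ≤ n := n.cast_nonneg
  simp only [eval_sub, eval_X, eval_C]
  linarith

theorem nodup_roots_mdlPoly (N : ℕ) : (mdlPoly (Real.exp 1) N).roots.Nodup := by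
  classical
  rw [Multiset.nodup_iff_count_le_one]
  intro a
  by_contra! h
  rw [count_roots] at h
  obtain ⟨q, hq⟩ := (pow_dvd_pow (X - C a) (Nat.succ_le_of_lt h)).trans
    (pow_rootMultiplicity_dvd (mdlPoly (Real.exp 1) N) a)
  refine not_nonneg_of_mdlPoly_eq_mul hq (by simp) fun n => ?_
  simp only [Nat.succ_eq_add_one, eval_pow]
  exact sq_nonneg _

/-! ### Nodes -/

theorem card_roots_toFinset_mdlPoly (N : ℕ) :
    (mdlPoly (Real.exp 1) N).roots.toFinset.card = N := by
  rw [Multiset.toFinset_card_of_nodup (nodup_roots_mdlPoly N),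
    card_roots_mdlPoly]

theorem node_eq_getElem {N k : ℕ} (hk : k < N) : node (Real.exp 1) N k =
    ((mdlPoly (Real.exp 1) N).roots.toFinset.sort (· ≤ ·))[k]'(by
      rwa [Finset.length_sort, card_roots_toFinset_mdlPoly]) := by
  rw [node, List.getD_eq_getElem]

theorem node_strictMonoOn (N : ℕ) : StrictMonoOn (node (Real.exp 1) N) (Set.Iio N) := by
  intro i hi j hj hij
  rw [node_eq_getElem hi, node_eq_getElem hj]
  exact List.pairwise_iff_getElem.1 (Finset.sortedLT_sort _).pairwise i j _ _ hij

theorem isRoot_node {N k : ℕ} (hk : k < N) :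
    (mdlPoly (Real.exp 1) N).IsRoot (node (Real.exp 1) N k) := by
  have : node (Real.exp 1) N k ∈
      (mdlPoly (Real.exp 1) N).roots.toFinset.sort (· ≤ ·) := by
    rw [node_eq_getElem hk]
    exact List.getElem_mem _
  rw [Finset.mem_sort, Multiset.mem_toFinset] at this
  exact isRoot_of_mem_roots this

theorem node_pos {N k : ℕ} (hk : k < N) : 0 < node (Real.exp 1) N k :=
  root_mdlPoly_pos (isRoot_node hk)

theorem node_injOn (N : ℕ) :
    Set.InjOn (node (Real.exp 1) N) (Finset.range N : Set ℕ) := by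
  rw [Finset.coe_range]
  exact (node_strictMonoOn N).injOn

/-- Only signs at integers matter: with no integer strictly between `a` and `b`, the factor `(X -
a)(X - b)` would be nonnegative at all of them. -/
theorem exists_nat_between_nodes {N k : ℕ} (hk : k + 1 < N) :
    ∃ n : ℕ, node (Real.exp 1) N k < n ∧ (n : ℝ) < node (Real.exp 1) N (k + 1) := by
  set a := node (Real.exp 1) N k
  set b := node (Real.exp 1) N (k + 1)
  have hab : a < b := node_strictMonoOn N (show k < N by omega) hk (Nat.lt_succ_self k)
  obtain ⟨q, hq⟩ := dvd_iff_isRoot.2 (isRoot_node (show k < N by omega))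
  have hb := isRoot_node hk
  rw [hq, IsRoot.def, eval_mul, mul_eq_zero] at hb
  have hqb : q.IsRoot b := hb.resolve_left (by simpa [sub_eq_zero] using hab.ne')
  obtain ⟨r, hr⟩ := dvd_iff_isRoot.2 hqb
  by_contra! hno
  refine not_nonneg_of_mdlPoly_eq_mul (f := (X - C a) * (X - C b)) (q := r)
    (by rw [hq, hr, mul_assoc]) ?_ fun n => ?_
  · rw [natDegree_mul (X_sub_C_ne_zero _) (X_sub_C_ne_zero _)]
    simp
  · simp only [eval_mul, eval_sub, eval_X, eval_C]
    rcases le_or_gt (n : ℝ) a with h | h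
    · exact mul_nonneg_of_nonpos_of_nonpos (by linarith) (by linarith)
    · have := hno n h
      exact mul_nonneg (by linarith) (by linarith)

theorem natCast_lt_node {N k : ℕ} (hk : k < N) : (k : ℝ) < node (Real.exp 1) N k := by
  induction k with
  | zero => simpa using node_pos hk
  | succ k ih =>
    obtain ⟨n, h1, h2⟩ := exists_nat_between_nodes hk
    have : k < n := by exact_mod_cast (ih (by omega)).trans h1
    exact lt_of_le_of_lt (by exact_mod_cast this) h2

/-! ### Gaussian quadrature -/

/-- The `N`-point quadrature sum `∑ k, w_k f(x_k)`. -/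
noncomputable def quad (N : ℕ) (f : ℝ → ℝ) : ℝ :=
  ∑ k ∈ Finset.range N, weight (Real.exp 1) N k * f (node (Real.exp 1) N k)

theorem quad_congr {N : ℕ} {f g : ℝ → ℝ}
    (h : ∀ k < N, f (node (Real.exp 1) N k) = g (node (Real.exp 1) N k)) :
    quad N f = quad N g :=
  Finset.sum_congr rfl fun k hk => by rw [h k (Finset.mem_range.1 hk)]

theorem quad_eq_massFunctional_of_degree_lt {N : ℕ} {p : ℝ[X]} (hp : p.degree < N) :
    quad N (fun x => p.eval x) = massFunctional p := by
  conv_rhs => rw [Lagrange.eq_interpolate (f := p) (node_injOn N) (by simpa using hp)]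
  rw [Lagrange.interpolate_apply, map_sum]
  refine Finset.sum_congr rfl fun k _ => ?_
  rw [massFunctional_C_mul, weight_eq, mul_comm]

theorem quad_eq_massFunctional {N : ℕ} {p : ℝ[X]} (hp : p.natDegree < 2 * N) :
    quad N (fun x => p.eval x) = massFunctional p := by
  have hP := mdlPoly_ne_zero N
  have hdiv := EuclideanDomain.div_add_mod p (mdlPoly (Real.exp 1) N)
  have hmod : (p % mdlPoly (Real.exp 1) N).degree < N := by
    have := degree_mod_lt p hP
    rwa [degree_mdlPoly] at this
  have hquot : (p / mdlPoly (Real.exp 1) N).degree < N := by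
    by_cases h0 : p / mdlPoly (Real.exp 1) N = 0
    · rw [h0, degree_zero]
      exact WithBot.bot_lt_coe N
    have hle : (mdlPoly (Real.exp 1) N).degree ≤ p.degree :=
      not_lt.1 fun h => h0 ((Polynomial.div_eq_zero_iff hP).2 h)
    have hadd := (degree_add_div hP hle).trans_le degree_le_natDegree
    rw [degree_mdlPoly, degree_eq_natDegree h0] at hadd
    have hadd' : N + (p / mdlPoly (Real.exp 1) N).natDegree ≤ p.natDegree := by
      exact_mod_cast hadd
    rw [degree_eq_natDegree h0]
    exact_mod_cast (by omega : (p / mdlPoly (Real.exp 1) N).natDegree < N)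
  have h : massFunctional p = massFunctional (p % mdlPoly (Real.exp 1) N) := by
    conv_lhs => rw [← hdiv]
    rw [map_add, massFunctional_mdlPoly_mul hquot, zero_add]
  rw [h, ← quad_eq_massFunctional_of_degree_lt hmod]
  refine quad_congr fun k hk => ?_
  conv_lhs => rw [← hdiv]
  rw [eval_add, eval_mul, (isRoot_node hk).eq_zero, zero_mul, zero_add]

/-- The rule is exact on the square of the Lagrange basis polynomial, of degree `2N - 2`, and
returns the weight. -/
theorem weight_pos {N k : ℕ} (hk : k < N) : 0 < weight (Real.exp 1) N k := by
  set ℓ := Lagrange.basis (Finset.range N) (node (Real.exp 1) N) k with hℓ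
  have hkm : k ∈ Finset.range N := Finset.mem_range.2 hk
  have h0 : ℓ ≠ 0 := Lagrange.basis_ne_zero (node_injOn N) hkm
  have hdeg : (ℓ * ℓ).natDegree < 2 * N := by
    rw [natDegree_mul h0 h0, hℓ, Lagrange.natDegree_basis (node_injOn N) hkm, Finset.card_range]
    omega
  have h := massFunctional_self_mul_self_pos h0
  rw [← quad_eq_massFunctional hdeg, quad, Finset.sum_eq_single_of_mem k hkm] at h
  · simpa [hℓ, Lagrange.eval_basis_self (node_injOn N) hkm] using h
  · intro j hj hjk
    rw [eval_mul, hℓ, Lagrange.eval_basis_of_ne hjk.symm hj]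
    simp

/-! ### Monomials of arbitrary degree -/

/-- Dividing a polynomial with nonnegative coefficients by a monic polynomial with nonnegative
roots leaves a quotient with nonnegative coefficients. -/
theorem exists_quotient_coeff_nonneg (s : Multiset ℝ) (hs : ∀ a ∈ s, 0 ≤ a) (p : ℝ[X])
    (hp : ∀ i, 0 ≤ p.coeff i) : ∃ q r : ℝ[X], p = (s.map fun a => X - C a).prod * q + r ∧
      (∀ i, 0 ≤ q.coeff i) ∧ r.degree < s.card := by
  induction s using Multiset.induction_on generalizing p with
  | empty => exact ⟨p, 0, by simp, hp, by simp⟩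
  | cons a s ih =>
    have ha : 0 ≤ a := hs a (Multiset.mem_cons_self a s)
    -- By Horner's scheme the quotient's coefficients are sums of powers of `a` times coefficients
    -- of `p`.
    have hq0 : ∀ i, 0 ≤ (p /ₘ (X - C a)).coeff i := fun i => by
      rw [coeff_divByMonic_X_sub_C]
      exact Finset.sum_nonneg fun j _ => mul_nonneg (pow_nonneg ha _) (hp j)
    obtain ⟨q, r, hqr, hq, hr⟩ := ih (fun b hb => hs b (Multiset.mem_cons_of_mem hb)) _ hq0
    refine ⟨q, (X - C a) * r + C (p.eval a), ?_, hq, ?_⟩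
    · conv_lhs => rw [← modByMonic_add_div p (X - C a), modByMonic_X_sub_C_eq_C_eval, hqr]
      rw [Multiset.map_cons, Multiset.prod_cons]
      ring
    · rw [Multiset.card_cons, degree_lt_iff_coeff_zero] at *
      intro m hm
      obtain ⟨m, rfl⟩ : ∃ l, m = l + 1 := ⟨m - 1, by omega⟩
      rw [coeff_add, sub_mul, coeff_sub, coeff_X_mul, coeff_C_mul, coeff_C_of_ne_zero (by omega),
        hr m (by omega), hr (m + 1) (by omega)]
      simp

theorem quad_add (N : ℕ) (f g : ℝ → ℝ) : quad N (fun x => f x + g x) = quad N f + quad N g := by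
  simp [quad, mul_add, Finset.sum_add_distrib]

theorem quad_const_mul (N : ℕ) (c : ℝ) (f : ℝ → ℝ) :
    quad N (fun x => c * f x) = c * quad N f := by
  simp only [quad, Finset.mul_sum]
  exact Finset.sum_congr rfl fun k _ => mul_left_comm _ _ _

theorem quad_sub (N : ℕ) (f g : ℝ → ℝ) : quad N (fun x => f x - g x) = quad N f - quad N g := by
  simp [quad, mul_sub, Finset.sum_sub_distrib]

theorem quad_mono {N : ℕ} {f g : ℝ → ℝ} (h : ∀ x, 0 ≤ x → f x ≤ g x) : quad N f ≤ quad N g :=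
  Finset.sum_le_sum fun _ hk => mul_le_mul_of_nonneg_left
    (h _ (node_pos (Finset.mem_range.1 hk)).le) (weight_pos (Finset.mem_range.1 hk)).le

theorem abs_quad_le (N : ℕ) (f : ℝ → ℝ) : |quad N f| ≤ quad N fun x => |f x| := by
  refine (Finset.abs_sum_le_sum_abs _ _).trans (Finset.sum_le_sum fun k hk => ?_)
  rw [abs_mul, abs_of_pos (weight_pos (Finset.mem_range.1 hk))]

/-- Write `X^j = P² q + r` with `P` the monic node polynomial. The rule sees only `r`, where it is
exact; the measure also sees `P² q`, nonnegative on the mass points because `q` has nonnegative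
coefficients. -/
theorem quad_pow_le (N j : ℕ) :
    quad N (fun x => x ^ j) ≤ ∑' n : ℕ, mass n * (n : ℝ) ^ j := by
  set s : Multiset ℝ := (Multiset.range N).map (node (Real.exp 1) N) with hs
  have hs0 : ∀ a ∈ s + s, 0 ≤ a := by
    intro a ha
    rw [Multiset.mem_add, or_self, hs, Multiset.mem_map] at ha
    obtain ⟨k, hk, rfl⟩ := ha
    exact (node_pos (Multiset.mem_range.1 hk)).le
  obtain ⟨q, r, hqr, hq, hr⟩ := exists_quotient_coeff_nonneg (s + s) hs0 (X ^ j) fun i => by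
    rw [coeff_X_pow]; split_ifs <;> norm_num
  rw [Multiset.map_add, Multiset.prod_add] at hqr
  set P : ℝ[X] := (s.map fun a => X - C a).prod with hP
  have hPn : ∀ k < N, P.eval (node (Real.exp 1) N k) = 0 := by
    intro k hk
    rw [hP, eval_multiset_prod, Multiset.prod_eq_zero_iff, Multiset.map_map, Multiset.mem_map]
    exact ⟨_, Multiset.mem_map_of_mem _ (Multiset.mem_range.2 hk), by simp⟩
  have hrq : quad N (fun x => x ^ j) = quad N fun x => r.eval x := by
    refine quad_congr fun k hk => ?_
    have := congrArg (eval (node (Real.exp 1) N k)) hqr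
    simpa [hPn k hk] using this
  have hrdeg : r = 0 ∨ r.natDegree < 2 * N := by
    by_cases h0 : r = 0
    · exact Or.inl h0
    · right
      rw [degree_eq_natDegree h0] at hr
      have : s.card = N := by simp [hs]
      rw [Multiset.card_add, this] at hr
      have : r.natDegree < N + N := by exact_mod_cast hr
      omega
  have hr2 : quad N (fun x => r.eval x) = massFunctional r := by
    rcases hrdeg with rfl | h
    · simp [quad]
    · exact quad_eq_massFunctional h
  have hX : massFunctional (X ^ j) = ∑' n : ℕ, mass n * (n : ℝ) ^ j := by
    simp [massFunctional_apply]
  rw [hrq, hr2, ← hX, hqr, map_add]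
  refine le_add_of_nonneg_left (massFunctional_nonneg fun n => ?_)
  rw [eval_mul, eval_mul]
  refine mul_nonneg (mul_self_nonneg _) ?_
  rw [eval_eq_sum_range]
  exact Finset.sum_nonneg fun i _ => mul_nonneg (hq i) (by positivity)

theorem quad_pow_le_factorial (N j : ℕ) : quad N (fun x => x ^ j) ≤ 2 * (j.factorial : ℝ) :=
  (quad_pow_le N j).trans (tsum_mass_mul_pow_lt j).le

/-! ### Functions on which the rule converges -/

/-- The quadrature sums of `f` converge to the sum of `f` against the masses. -/
def QuadConverges (f : ℝ → ℝ) : Prop :=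
  (Summable fun n : ℕ => mass n * f n) ∧
    Tendsto (fun N => quad N f) atTop (𝓝 (∑' n : ℕ, mass n * f n))

theorem QuadConverges.add {f g : ℝ → ℝ} (hf : QuadConverges f) (hg : QuadConverges g) :
    QuadConverges fun x => f x + g x := by
  refine ⟨by simpa only [mul_add] using hf.1.add hg.1, ?_⟩
  simp only [quad_add, mul_add]
  rw [hf.1.tsum_add hg.1]
  exact hf.2.add hg.2

theorem QuadConverges.const_mul {f : ℝ → ℝ} (c : ℝ) (hf : QuadConverges f) :
    QuadConverges fun x => c * f x := by
  simp only [QuadConverges, quad_const_mul, mul_left_comm _ c, tsum_mul_left]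
  exact ⟨hf.1.mul_left c, hf.2.const_mul c⟩

theorem quadConverges_eval (p : ℝ[X]) : QuadConverges fun x => p.eval x := by
  refine ⟨summable_mass_mul_eval p, tendsto_const_nhds.congr' ?_⟩
  filter_upwards [eventually_gt_atTop p.natDegree] with N hN
  rw [quad_eq_massFunctional (by omega), massFunctional_apply]

theorem quadConverges_pow (j : ℕ) : QuadConverges fun x => x ^ j := by
  simpa using quadConverges_eval (X ^ j)

/-- Dominated convergence in the series index: `2 |a i| (d i)!` bounds the `i`-th term uniformly in
`N`, and also justifies exchanging the two sums for the measure. -/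
theorem QuadConverges.of_hasSum {f : ℝ → ℝ} {g : ℕ → ℝ → ℝ} {a : ℕ → ℝ} {d : ℕ → ℕ}
    (hf : ∀ x, 0 ≤ x → HasSum (fun i => a i * g i x) (f x))
    (hg : ∀ i, QuadConverges (g i)) (hb : ∀ i x, 0 ≤ x → |g i x| ≤ x ^ d i)
    (ha : Summable fun i => |a i| * ((d i).factorial : ℝ)) : QuadConverges f := by
  have hquad : ∀ N, quad N f = ∑' i, a i * quad N (g i) := by
    intro N
    refine (HasSum.tsum_eq ?_).symm
    have := hasSum_sum fun k (hk : k ∈ Finset.range N) =>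
      (hf _ (node_pos (Finset.mem_range.1 hk)).le).mul_left (weight (Real.exp 1) N k)
    refine this.congr_fun fun i => ?_
    rw [quad, Finset.mul_sum]
    exact Finset.sum_congr rfl fun k _ => mul_left_comm _ _ _
  have hmaj : Summable fun z : ℕ × ℕ => |a z.1| * (mass z.2 * (z.2 : ℝ) ^ d z.1) := by
    have hnn : 0 ≤ fun z : ℕ × ℕ => |a z.1| * (mass z.2 * (z.2 : ℝ) ^ d z.1) := by
      intro z
      have hz := mass_nonneg z.2
      simp only [Pi.zero_apply]
      positivity
    refine (summable_prod_of_nonneg hnn).2 ⟨fun i => ?_, ?_⟩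
    · exact (summable_mass_mul_pow (d i)).mul_left |a i|
    simp only [tsum_mul_left]
    refine (ha.mul_left 2).of_nonneg_of_le (fun i => mul_nonneg (abs_nonneg _)
      (tsum_nonneg fun n => mul_nonneg (mass_nonneg n) (by positivity))) fun i => ?_
    rw [mul_left_comm]
    exact mul_le_mul_of_nonneg_left (tsum_mass_mul_pow_lt (d i)).le (abs_nonneg _)
  have hsum : Summable fun z : ℕ × ℕ => mass z.2 * (a z.1 * g z.1 z.2) := by
    refine hmaj.of_norm_bounded fun z => ?_
    rw [Real.norm_eq_abs, abs_mul, abs_mul, abs_of_pos (mass_pos _), mul_left_comm]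
    gcongr
    · exact mass_nonneg _
    · exact hb _ _ (Nat.cast_nonneg _)
  have hinner : ∀ n : ℕ, ∑' i, mass n * (a i * g i n) = mass n * f n := fun n =>
    ((hf n n.cast_nonneg).mul_left (mass n)).tsum_eq
  have hmass : ∑' n : ℕ, mass n * f n = ∑' i, a i * ∑' n : ℕ, mass n * g i n := by
    simp only [← hinner]
    rw [Summable.tsum_comm (f := fun i n : ℕ => mass n * (a i * g i n)) hsum]
    refine tsum_congr fun i => ?_
    rw [← tsum_mul_left]
    exact tsum_congr fun n => mul_left_comm _ _ _
  refine ⟨?_, ?_⟩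
  · refine (((Equiv.prodComm ℕ ℕ).summable_iff.2 hsum).prod).congr fun n => ?_
    exact hinner n
  · simp only [hquad]
    rw [hmass]
    refine tendsto_tsum_of_dominated_convergence (ha.mul_left 2)
      (fun i => (hg i).2.const_mul (a i)) (Eventually.of_forall fun N i => ?_)
    rw [Real.norm_eq_abs, abs_mul, mul_left_comm]
    refine mul_le_mul_of_nonneg_left ?_ (abs_nonneg _)
    exact (abs_quad_le N _).trans ((quad_mono (hb i)).trans (quad_pow_le_factorial N _))

/-- The terms are `j! * ((i + j) choose j) * 2^{-i}`. The ratio `1/2` is why exponentials are built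
in steps of `e^{-x/2}`; with `e^{-x}` the series would diverge. -/
theorem summable_half_pow_div_factorial_mul_factorial (j : ℕ) :
    Summable fun i : ℕ => |(-(1 / 2) : ℝ) ^ i / (i.factorial : ℝ)| * ((j + i).factorial : ℝ) := by
  have h := (summable_choose_mul_geometric_of_norm_lt_one (R := ℝ) j
    (r := 1 / 2) (by norm_num)).mul_left (j.factorial : ℝ)
  refine h.congr fun i => ?_
  have h1 : ((i + j).choose j : ℝ) * i.factorial * j.factorial = (j + i).factorial := by
    rw [add_comm j i]
    exact_mod_cast Nat.add_choose_mul_factorial_mul_factorial i j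
  rw [← h1, abs_div, abs_pow, abs_neg, abs_of_pos (by norm_num : (0 : ℝ) < 1 / 2), Nat.abs_cast]
  field_simp

/-- Only the newest factor `e^{-x/2}` is expanded. The earlier ones stay inside `g i`, where they
are at most `1`; the expansion raises the power of `x`, so `j` must vary. -/
theorem quadConverges_pow_mul_exp (m j : ℕ) :
    QuadConverges fun x => x ^ j * Real.exp (-(m / 2 : ℝ) * x) := by
  induction m generalizing j with
  | zero => simpa using quadConverges_pow j
  | succ m ih =>
    refine QuadConverges.of_hasSum (a := fun i => (-(1 / 2) : ℝ) ^ i / (i.factorial : ℝ))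
      (g := fun i x => x ^ (j + i) * Real.exp (-(m / 2 : ℝ) * x)) (d := fun i => j + i)
      (fun x _ => ?_) (fun i => ih (j + i)) (fun i x hx => ?_)
      (summable_half_pow_div_factorial_mul_factorial j)
    · have h := (NormedSpace.expSeries_div_hasSum_exp (-(1 / 2) * x : ℝ)).mul_left
        (x ^ j * Real.exp (-(m / 2 : ℝ) * x))
      rw [← Real.exp_eq_exp_ℝ, mul_assoc, ← Real.exp_add] at h
      rw [show -((m + 1 : ℕ) / 2 : ℝ) * x = -(m / 2 : ℝ) * x + -(1 / 2) * x by push_cast; ring]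
      refine h.congr_fun fun i => ?_
      rw [mul_pow, pow_add]
      ring
    · rw [abs_of_nonneg (by positivity)]
      refine mul_le_of_le_one_right (by positivity) (Real.exp_le_one_iff.2 ?_)
      have : (0 : ℝ) ≤ m / 2 := by positivity
      nlinarith

theorem quadConverges_eval_exp (p : ℝ[X]) :
    QuadConverges fun x => p.eval (Real.exp (-x / 2)) := by
  induction p using Polynomial.induction_on' with
  | add p q hp hq => simpa only [eval_add] using hp.add hq
  | monomial k a =>
    have h := (quadConverges_pow_mul_exp k 0).const_mul a
    convert h using 2 with x
    rw [eval_monomial, ← Real.exp_nat_mul, pow_zero, one_mul]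
    congr 2
    ring

theorem exp_neg_half_mem_Icc {x : ℝ} (hx : 0 ≤ x) : Real.exp (-x / 2) ∈ Set.Icc (0 : ℝ) 1 :=
  ⟨(Real.exp_pos _).le, Real.exp_le_one_iff.2 (by linarith)⟩

theorem abs_quad_sub_le {N : ℕ} {f g : ℝ → ℝ} {c : ℝ} (hc : 0 ≤ c)
    (h : ∀ x, 0 ≤ x → |f x - g x| ≤ c) : |quad N f - quad N g| ≤ 2 * c := by
  rw [← quad_sub]
  have h1 : quad N (fun x => |f x - g x|) ≤ quad N fun x => c * x ^ 0 :=
    quad_mono fun x hx => by simpa using h x hx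
  rw [quad_const_mul] at h1
  have h2 := mul_le_mul_of_nonneg_left (quad_pow_le_factorial N 0) hc
  have h3 := abs_quad_le N fun x => f x - g x
  simp only [Nat.factorial_zero, Nat.cast_one, mul_one] at h2
  linarith

theorem abs_tsum_sub_le {f g : ℝ → ℝ} {c : ℝ} (hc : 0 ≤ c)
    (hf : Summable fun n : ℕ => mass n * f n) (hg : Summable fun n : ℕ => mass n * g n)
    (h : ∀ x, 0 ≤ x → |f x - g x| ≤ c) :
    |∑' n : ℕ, mass n * f n - ∑' n : ℕ, mass n * g n| ≤ 2 * c := by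
  rw [← hf.tsum_sub hg]
  have h0 := tsum_mass_mul_pow_lt 0
  simp only [pow_zero, Nat.factorial_zero, Nat.cast_one, mul_one] at h0
  have hm : Summable fun n : ℕ => c * mass n := by
    simpa using (summable_mass_mul_pow 0).mul_left c
  have := tsum_of_norm_bounded hm.hasSum (f := fun n : ℕ => mass n * f n - mass n * g n)
    fun n => by
      rw [Real.norm_eq_abs, ← mul_sub, abs_mul, abs_of_pos (mass_pos n), mul_comm]
      exact mul_le_mul_of_nonneg_right (h n n.cast_nonneg) (mass_nonneg n)
  rw [Real.norm_eq_abs, tsum_mul_left] at this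
  nlinarith

theorem quadConverges_comp_exp {g : ℝ → ℝ} (hg : ContinuousOn g (Set.Icc 0 1)) :
    QuadConverges fun x => g (Real.exp (-x / 2)) := by
  have hsum : Summable fun n : ℕ => mass n * g (Real.exp (-(n : ℝ) / 2)) := by
    obtain ⟨B, hB⟩ := isCompact_Icc.exists_bound_of_continuousOn hg
    have hm : Summable mass := by simpa using summable_mass_mul_pow 0
    refine (hm.mul_right B).of_norm_bounded fun n => ?_
    rw [norm_mul, Real.norm_of_nonneg (mass_nonneg n)]
    exact mul_le_mul_of_nonneg_left (hB _ (exp_neg_half_mem_Icc n.cast_nonneg)) (mass_nonneg n)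
  refine ⟨hsum, Metric.tendsto_atTop.2 fun ε hε => ?_⟩
  -- Both the rule and the measure have total mass at most `2`, so the error is `2ε/5 + ε/5 + 2ε/5`.
  obtain ⟨p, hp⟩ := exists_polynomial_near_of_continuousOn 0 1 g hg (ε / 5) (by positivity)
  have hpc := quadConverges_eval_exp p
  obtain ⟨N₀, hN₀⟩ := Metric.tendsto_atTop.1 hpc.2 (ε / 5) (by positivity)
  have hclose : ∀ x, 0 ≤ x →
      |p.eval (Real.exp (-x / 2)) - g (Real.exp (-x / 2))| ≤ ε / 5 :=
    fun x hx => (hp _ (exp_neg_half_mem_Icc hx)).le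
  refine ⟨N₀, fun N hN => ?_⟩
  have h1 := hN₀ N hN
  have h2 := abs_quad_sub_le (N := N) (f := fun x => p.eval (Real.exp (-x / 2)))
    (g := fun x => g (Real.exp (-x / 2))) (c := ε / 5) (by positivity) hclose
  have h3 := abs_tsum_sub_le (f := fun x => p.eval (Real.exp (-x / 2)))
    (g := fun x => g (Real.exp (-x / 2))) (c := ε / 5) (by positivity) hpc.1 hsum hclose
  rw [Real.dist_eq] at h1 ⊢
  rw [abs_lt] at h1 ⊢
  rw [abs_le] at h2 h3
  constructor <;> linarith

/-! ### Convergence of nodes and weights -/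

/-- The image of a point under the decreasing chart `x ↦ e^{-x/2}`. -/
noncomputable def chart (x : ℝ) : ℝ := Real.exp (-x / 2)

theorem chart_strictAnti : StrictAnti chart := fun x y h => by
  unfold chart
  exact Real.exp_lt_exp.2 (by linarith)

theorem continuous_chart : Continuous chart := by
  unfold chart
  fun_prop

/-- A tent function of height `1` and half width `c` at the point `k`, in the chart. -/
noncomputable def tent (k : ℕ) (c x : ℝ) : ℝ := max 0 (1 - |chart x - chart k| / c)

theorem tent_eq_zero {k : ℕ} {c x : ℝ} (hc : 0 < c) (h : c ≤ |chart x - chart k|) :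
    tent k c x = 0 :=
  max_eq_left (by rw [sub_nonpos, one_le_div hc]; exact h)

theorem tent_self (k : ℕ) (c : ℝ) : tent k c k = 1 := by simp [tent]

/-- The distance from the point `k` to the next one on the right, in the chart. -/
noncomputable def gap (k : ℕ) : ℝ := chart k - chart (k + 1)

theorem gap_pos (k : ℕ) : 0 < gap k := sub_pos.2 (chart_strictAnti (lt_add_one _))

theorem chart_lt_chart_sub_gap {k : ℕ} {x : ℝ} (h : (k : ℝ) + 1 < x) :
    chart x < chart k - gap k := by
  have := chart_strictAnti h
  unfold gap
  linarith

/-- The chart is convex, so the gap to the left of `k` exceeds the one to the right, and a tent of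
half width `gap k` vanishes at all other integers. -/
theorem chart_add_gap_lt_chart {k : ℕ} {x : ℝ} (h : x ≤ (k : ℝ) - 1) :
    chart k + gap k < chart x := by
  have h1 := chart_strictAnti.antitone h
  have h2 : chart (k - 1 : ℝ) = chart k * Real.exp (1 / 2) := by
    rw [chart, chart, ← Real.exp_add]; congr 1; ring
  have h3 : chart (k + 1 : ℝ) = chart k * Real.exp (-(1 / 2)) := by
    rw [chart, chart, ← Real.exp_add]; congr 1; ring
  have hk : 0 < chart k := Real.exp_pos _
  have h4 : 2 < Real.exp (1 / 2) + Real.exp (-(1 / 2)) := by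
    have := Real.add_one_lt_exp (x := 1 / 2) (by norm_num)
    have := Real.add_one_lt_exp (x := -(1 / 2)) (by norm_num)
    linarith
  unfold gap
  nlinarith

theorem quadConverges_tent (k : ℕ) (c : ℝ) : QuadConverges (tent k c) :=
  quadConverges_comp_exp (g := fun u => max 0 (1 - |u - chart k| / c)) (by fun_prop)

theorem tendsto_quad_tent {k : ℕ} {c : ℝ} (hc : 0 < c) (hck : c ≤ gap k) :
    Tendsto (fun N => quad N (tent k c)) atTop (𝓝 (mass k)) := by
  have h := (quadConverges_tent k c).2
  rwa [tsum_eq_single k, tent_self, mul_one] at h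
  intro n hn
  rw [tent_eq_zero hc, mul_zero]
  rcases hn.lt_or_gt with h | h
  · have := chart_add_gap_lt_chart (k := k) (x := n)
      (by rw [le_sub_iff_add_le]; exact_mod_cast h)
    exact le_abs.2 (Or.inl (by linarith))
  · have : chart n ≤ chart ((k : ℝ) + 1) := chart_strictAnti.antitone (by exact_mod_cast h)
    unfold gap at hck
    exact le_abs.2 (Or.inr (by linarith))

/-- Eventually the only node in the support of the tent at `k` is the `k`-th one. -/
theorem eventually_quad_tent_eq {k : ℕ}
    (ih : ∀ i < k, Tendsto (fun N => node (Real.exp 1) N i) atTop (𝓝 (i : ℝ)))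
    {c : ℝ} (hc : 0 < c) (hck : c ≤ gap k) : ∀ᶠ N in atTop, k < N ∧ quad N (tent k c) =
      weight (Real.exp 1) N k * tent k c (node (Real.exp 1) N k) := by
  -- Nodes of smaller index leave the tent by `ih`; those of larger index exceed `k + 1` by
  -- `natCast_lt_node`.
  have hleft : ∀ᶠ N in atTop, ∀ i ∈ Finset.range k,
      chart k + gap k < chart (node (Real.exp 1) N i) := by
    rw [Finset.eventually_all]
    intro i hi
    have hik : i < k := Finset.mem_range.1 hi
    have ht := (continuous_chart.tendsto _).comp (ih i hik)
    exact ht.eventually_const_lt (chart_add_gap_lt_chart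
      (by rw [le_sub_iff_add_le]; exact_mod_cast hik))
  filter_upwards [hleft, eventually_gt_atTop k] with N hN hkN
  refine ⟨hkN, Finset.sum_eq_single_of_mem k (Finset.mem_range.2 hkN) fun i hi hik => ?_⟩
  rw [tent_eq_zero hc, mul_zero]
  rcases hik.lt_or_gt with h | h
  · have := hN i (Finset.mem_range.2 h)
    exact le_abs.2 (Or.inl (by linarith))
  · have h1 : ((k + 1 : ℕ) : ℝ) ≤ i := by exact_mod_cast h
    push_cast at h1
    have := chart_lt_chart_sub_gap (h1.trans_lt (natCast_lt_node (Finset.mem_range.1 hi)))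
    exact le_abs.2 (Or.inr (by linarith))

/-- Were the node of index `k` outside the tent, the quadrature sum would be `0`, yet it tends to
`mass k > 0`. The tent may be arbitrarily narrow. -/
theorem tendsto_node (k : ℕ) :
    Tendsto (fun N => node (Real.exp 1) N k) atTop (𝓝 (k : ℝ)) := by
  induction k using Nat.strong_induction_on with
  | _ k ih =>
    have hchart : Tendsto (fun N => chart (node (Real.exp 1) N k)) atTop (𝓝 (chart k)) := by
      refine Metric.tendsto_nhds.2 fun ε hε => ?_
      have hc : 0 < min ε (gap k) := lt_min hε (gap_pos k)
      filter_upwards [eventually_quad_tent_eq ih hc (min_le_right _ _),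
        (tendsto_quad_tent hc (min_le_right _ _)).eventually_const_lt (mass_pos k)]
        with N ⟨_, h1⟩ h2
      rw [Real.dist_eq]
      by_contra! h
      rw [h1, tent_eq_zero hc ((min_le_left _ _).trans h), mul_zero] at h2
      exact lt_irrefl _ h2
    have hlog : ∀ x, -2 * Real.log (chart x) = x := fun x => by
      rw [chart, Real.log_exp]; ring
    have := (hchart.log (Real.exp_pos _).ne').const_mul (-2)
    simpa only [hlog] using this

/-- Divide the quadrature sum of the tent by the tent's value at the node, which tends to `1`. -/
theorem tendsto_weight (k : ℕ) :
    Tendsto (fun N => weight (Real.exp 1) N k) atTop (𝓝 (mass k)) := by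
  have hcont : Continuous (tent k (gap k)) := by
    have := continuous_chart
    unfold tent
    fun_prop
  have ht := (hcont.tendsto _).comp (tendsto_node k)
  rw [tent_self] at ht
  have hdiv := (tendsto_quad_tent (gap_pos k) le_rfl).div ht one_ne_zero
  rw [div_one] at hdiv
  refine hdiv.congr' ?_
  filter_upwards [eventually_quad_tent_eq (fun i _ => tendsto_node i) (gap_pos k) le_rfl,
    ht.eventually_const_lt one_pos] with N ⟨_, h1⟩ h2
  simp only [Function.comp_apply, Pi.div_apply] at h2 ⊢
  rw [h1, mul_div_cancel_right₀ _ h2.ne']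

/-! ### A power series majorant of `eˣ (x + 1)⁻ᵖ` -/

/-- The power series `∑ i, (i + 1)⁻ᵖ xⁱ / i!`. -/
noncomputable def majorant (p x : ℝ) : ℝ :=
  ∑' i : ℕ, ((i : ℝ) + 1) ^ (-p) / (i.factorial : ℝ) * x ^ i

theorem rpow_neg_natCast_add_one_le_one {p : ℝ} (hp : 0 ≤ p) (i : ℕ) :
    ((i : ℝ) + 1) ^ (-p) ≤ 1 :=
  Real.rpow_le_one_of_one_le_of_nonpos (by linarith [(i.cast_nonneg : (0 : ℝ) ≤ i)])
    (neg_nonpos.2 hp)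

theorem hasSum_majorant {p x : ℝ} (hp : 0 ≤ p) (hx : 0 ≤ x) :
    HasSum (fun i : ℕ => ((i : ℝ) + 1) ^ (-p) / (i.factorial : ℝ) * x ^ i) (majorant p x) := by
  refine Summable.hasSum ((Real.summable_pow_div_factorial x).of_nonneg_of_le
    (fun i => by positivity) fun i => ?_)
  rw [div_mul_eq_mul_div]
  gcongr
  exact mul_le_of_le_one_left (by positivity) (rpow_neg_natCast_add_one_le_one hp i)

theorem majorant_mono {p x y : ℝ} (hp : 0 ≤ p) (hx : 0 ≤ x) (hxy : x ≤ y) :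
    majorant p x ≤ majorant p y :=
  hasSum_le (fun i => by gcongr) (hasSum_majorant hp hx) (hasSum_majorant hp (hx.trans hxy))

/-- The tangent at `1` lies below the convex function `y^{-p}`. -/
theorem one_sub_mul_sub_one_le_rpow_neg {p y : ℝ} (hp : 0 ≤ p) (hy : 0 < y) :
    1 - p * (y - 1) ≤ y ^ (-p) := by
  rw [Real.rpow_def_of_pos hy]
  have h1 := Real.add_one_le_exp (Real.log y * -p)
  have h2 := mul_le_mul_of_nonneg_left (Real.log_le_sub_one_of_pos hy) hp
  linarith

theorem hasSum_pow_div_factorial (x : ℝ) :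
    HasSum (fun i : ℕ => x ^ i / (i.factorial : ℝ)) (Real.exp x) := by
  have h := NormedSpace.expSeries_div_hasSum_exp x
  rwa [← Real.exp_eq_exp_ℝ] at h

theorem hasSum_natCast_mul_pow_div_factorial (x : ℝ) :
    HasSum (fun i : ℕ => (i : ℝ) * (x ^ i / (i.factorial : ℝ))) (x * Real.exp x) := by
  rw [← hasSum_nat_add_iff' 1]
  simp only [Finset.range_one, Finset.sum_singleton, CharP.cast_eq_zero, zero_mul, sub_zero]
  refine ((hasSum_pow_div_factorial x).mul_left x).congr_fun fun i => ?_
  rw [Nat.factorial_succ, pow_succ]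
  push_cast
  field_simp

/-- Jensen's inequality for a Poisson variable `i` of mean `x`: `E (i + 1)^{-p} ≥ (x + 1)^{-p}`. The
tangent bound, rescaled to touch at `x + 1`, is summed against `xⁱ / i!`. -/
theorem exp_mul_rpow_le_majorant {p x : ℝ} (hp : 0 ≤ p) (hx : 0 ≤ x) :
    Real.exp x * (x + 1) ^ (-p) ≤ majorant p x := by
  have hx1 : 0 < x + 1 := by linarith
  have h := (((hasSum_pow_div_factorial x).mul_left (1 + p * x / (x + 1))).sub
    ((hasSum_natCast_mul_pow_div_factorial x).mul_left (p / (x + 1)))).mul_left ((x + 1) ^ (-p))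
  have hval : (x + 1) ^ (-p) * ((1 + p * x / (x + 1)) * Real.exp x -
      p / (x + 1) * (x * Real.exp x)) = Real.exp x * (x + 1) ^ (-p) := by ring
  rw [hval] at h
  refine hasSum_le (fun i => ?_) h (hasSum_majorant hp hx)
  have hi : (0 : ℝ) < (i : ℝ) + 1 := by positivity
  have hkey := one_sub_mul_sub_one_le_rpow_neg hp (div_pos hi hx1)
  rw [Real.div_rpow hi.le hx1.le, le_div_iff₀ (by positivity)] at hkey
  have hfac : 0 ≤ x ^ i / (i.factorial : ℝ) := by positivity
  calc (x + 1) ^ (-p) * ((1 + p * x / (x + 1)) * (x ^ i / (i.factorial : ℝ)) -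
        p / (x + 1) * ((i : ℝ) * (x ^ i / (i.factorial : ℝ))))
      = (1 - p * (((i : ℝ) + 1) / (x + 1) - 1)) * (x + 1) ^ (-p) *
        (x ^ i / (i.factorial : ℝ)) := by field_simp; ring
    _ ≤ ((i : ℝ) + 1) ^ (-p) * (x ^ i / (i.factorial : ℝ)) :=
        mul_le_mul_of_nonneg_right hkey hfac
    _ = ((i : ℝ) + 1) ^ (-p) / (i.factorial : ℝ) * x ^ i := by ring

/-- Coefficient times factorial is `(i + 1)^{-p}`, summable because `p > 1`; this is where the decay
rate of `F` enters. -/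
theorem quadConverges_majorant {p : ℝ} (hp : 1 < p) : QuadConverges (majorant p) := by
  refine QuadConverges.of_hasSum (g := fun i x => x ^ i) (d := fun i => i)
    (fun x hx => hasSum_majorant (by linarith) hx) quadConverges_pow
    (fun i x hx => by rw [abs_of_nonneg (by positivity)]) ?_
  have h := (summable_nat_add_iff 1).2 (Real.summable_nat_rpow.2 (by linarith : -p < -1))
  refine h.congr fun i => ?_
  rw [abs_of_nonneg (by positivity), div_mul_cancel₀ _ (by positivity)]
  push_cast
  rfl

/-! ### Convergence of the rule -/

theorem tendsto_weight_mul_apply_node {f : ℝ → ℝ} {k : ℕ}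
    (hf : ContinuousWithinAt f (Set.Ici (k : ℝ)) (k : ℝ)) :
    Tendsto (fun N => weight (Real.exp 1) N k * f (node (Real.exp 1) N k)) atTop
      (𝓝 (mass k * f k)) := by
  refine (tendsto_weight k).mul (hf.tendsto.comp (tendsto_nhdsWithin_iff.2 ⟨tendsto_node k, ?_⟩))
  filter_upwards [eventually_gt_atTop k] with N hN
  exact (natCast_lt_node hN).le

/-- The quadrature sums of a function that is right-continuous at the mass points converge as soon
as it is eventually dominated by an increasing function with convergent quadrature sums. -/
theorem tendsto_quad_of_le {f G : ℝ → ℝ} {C x₀ : ℝ} (hC : 0 ≤ C)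
    (hsum : Summable fun n : ℕ => mass n * f n)
    (hf : ∀ n : ℕ, ContinuousWithinAt f (Set.Ici (n : ℝ)) (n : ℝ)) (hG : QuadConverges G)
    (hmono : ∀ x y, 0 ≤ x → x ≤ y → G x ≤ G y) (hle : ∀ x, x₀ ≤ x → |f x| ≤ C * G x) :
    Tendsto (fun N => quad N f) atTop (𝓝 (∑' n : ℕ, mass n * f n)) := by
  refine Metric.tendsto_atTop'.2 fun ε hε => ?_
  have hGK := ((tendsto_const_nhds (x := ∑' n : ℕ, mass n * G n)).sub
    hG.1.hasSum.tendsto_sum_nat).const_mul C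
  rw [sub_self, mul_zero] at hGK
  have hfK := Metric.tendsto_nhds.1 hsum.hasSum.tendsto_sum_nat (ε / 4) (by positivity)
  -- The cut `K` makes the tails of `C * G` and of `f` under the masses smaller than `ε / 4`. Head
  -- and tail of the rule will each add at most `ε / 4`.
  obtain ⟨K, hKG, hKf, hKx⟩ := ((hGK.eventually_lt_const (by positivity : 0 < ε / 4)).and
    (hfK.and (eventually_ge_atTop ⌈x₀⌉₊))).exists
  have hKx' : x₀ ≤ K := (Nat.le_ceil x₀).trans (by exact_mod_cast hKx)
  have hhead : Tendsto (fun N => ∑ k ∈ Finset.range K,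
      weight (Real.exp 1) N k * f (node (Real.exp 1) N k)) atTop
      (𝓝 (∑ k ∈ Finset.range K, mass k * f k)) :=
    tendsto_finsetSum _ fun k _ => tendsto_weight_mul_apply_node (hf k)
  have htail : Tendsto (fun N => C * (quad N G - ∑ k ∈ Finset.range K,
      weight (Real.exp 1) N k * G k)) atTop
      (𝓝 (C * (∑' n : ℕ, mass n * G n - ∑ k ∈ Finset.range K, mass k * G k))) :=
    (hG.2.sub (tendsto_finsetSum _ fun k _ => (tendsto_weight k).mul_const _)).const_mul C
  obtain ⟨N₀, hN₀⟩ := eventually_atTop.1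
    ((Metric.tendsto_nhds.1 hhead (ε / 4) (by positivity)).and
      ((htail.eventually_lt_const hKG).and (eventually_gt_atTop K)))
  refine ⟨N₀, fun N hN => ?_⟩
  obtain ⟨h1, h2, hKN⟩ := hN₀ N hN.le
  have hsplit : ∀ g : ℝ → ℝ, quad N g = ∑ k ∈ Finset.range K,
      weight (Real.exp 1) N k * g (node (Real.exp 1) N k) +
      ∑ k ∈ Finset.Ico K N, weight (Real.exp 1) N k * g (node (Real.exp 1) N k) := fun g =>
    (Finset.sum_range_add_sum_Ico _ hKN.le).symm
  have h3 : |∑ k ∈ Finset.Ico K N, weight (Real.exp 1) N k * f (node (Real.exp 1) N k)| ≤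
      C * (quad N G - ∑ k ∈ Finset.range K, weight (Real.exp 1) N k * G k) := by
    -- Since `G` increases and each node exceeds its index, replacing nodes by indices in the head
    -- only enlarges the tail bound. No continuity of `G` is needed.
    have hGhead : ∑ k ∈ Finset.range K, weight (Real.exp 1) N k * G k ≤ ∑ k ∈ Finset.range K,
        weight (Real.exp 1) N k * G (node (Real.exp 1) N k) := by
      refine Finset.sum_le_sum fun k hk => ?_
      have hkN : k < N := (Finset.mem_range.1 hk).trans hKN
      exact mul_le_mul_of_nonneg_left
        (hmono _ _ k.cast_nonneg (natCast_lt_node hkN).le) (weight_pos hkN).le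
    calc _ ≤ ∑ k ∈ Finset.Ico K N,
          C * (weight (Real.exp 1) N k * G (node (Real.exp 1) N k)) := by
          refine (Finset.abs_sum_le_sum_abs _ _).trans (Finset.sum_le_sum fun k hk => ?_)
          obtain ⟨hKk, hkN⟩ := Finset.mem_Ico.1 hk
          have hx : x₀ ≤ node (Real.exp 1) N k :=
            hKx'.trans ((by exact_mod_cast hKk : (K : ℝ) ≤ k).trans (natCast_lt_node hkN).le)
          rw [abs_mul, abs_of_pos (weight_pos hkN), mul_left_comm]
          exact mul_le_mul_of_nonneg_left (hle _ hx) (weight_pos hkN).le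
      _ = C * (quad N G - ∑ k ∈ Finset.range K,
          weight (Real.exp 1) N k * G (node (Real.exp 1) N k)) := by
          rw [← Finset.mul_sum, hsplit G, add_sub_cancel_left]
      _ ≤ _ := by gcongr
  rw [Real.dist_eq, abs_lt] at *
  rw [abs_le] at h3
  rw [hsplit f]
  constructor <;> linarith

theorem mass_mul_exp (F : ℝ → ℝ) (n : ℕ) :
    mass n * (Real.exp n * F n) = if n = 0 then F 0 / 2 else F n := by
  unfold mass
  split_ifs with h
  · subst h; simp; ring
  · rw [← mul_assoc, ← Real.exp_add, neg_add_cancel, Real.exp_zero, one_mul]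

theorem summable_mass_mul_exp {F : ℝ → ℝ} (hF : Summable fun n : ℕ => F n) :
    Summable fun n : ℕ => mass n * (Real.exp n * F n) := by
  rw [← summable_nat_add_iff 1] at hF ⊢
  refine hF.congr fun n => ?_
  rw [mass_mul_exp, if_neg n.succ_ne_zero]

theorem tsum_mass_mul_exp {F : ℝ → ℝ} (hF : Summable fun n : ℕ => F n) :
    ∑' n : ℕ, mass n * (Real.exp n * F n) = primedSum fun n => F n := by
  rw [(summable_mass_mul_exp hF).tsum_eq_zero_add, mass_mul_exp, if_pos rfl, primedSum,
    Nat.cast_zero]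
  congr 1
  refine tsum_congr fun n => ?_
  rw [mass_mul_exp, if_neg n.succ_ne_zero]

theorem summable_of_isBigO_rpow {F : ℝ → ℝ} {ε : ℝ} (hε : 0 < ε)
    (hF : F =O[atTop] (fun x : ℝ => x ^ (-(1 + ε)))) : Summable fun n : ℕ => F n :=
  summable_of_isBigO_nat (Real.summable_nat_rpow.2 (by linarith : -(1 + ε) < -1))
    (hF.comp_tendsto tendsto_natCast_atTop_atTop)

theorem rpow_neg_le_two_rpow_mul {p x : ℝ} (hp : 0 ≤ p) (hx : 1 ≤ x) :
    x ^ (-p) ≤ 2 ^ p * (x + 1) ^ (-p) := by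
  have h := Real.rpow_le_rpow_of_nonpos (by linarith : 0 < (x + 1) / 2)
    (by linarith : (x + 1) / 2 ≤ x) (neg_nonpos.2 hp)
  rwa [Real.div_rpow (by linarith) zero_le_two, Real.rpow_neg zero_le_two, div_inv_eq_mul,
    mul_comm] at h

theorem tendsto_rule {F : ℝ → ℝ} {ε : ℝ} (hε : 0 < ε)
    (hF : F =O[atTop] (fun x : ℝ => x ^ (-(1 + ε))))
    (hcont : ∀ n : ℕ, ContinuousWithinAt F (Set.Ici (n : ℝ)) (n : ℝ)) :
    Tendsto (fun N => rule N F) atTop (𝓝 (primedSum fun n => F n)) := by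
  have hsum := summable_of_isBigO_rpow hε hF
  rw [← tsum_mass_mul_exp hsum]
  obtain ⟨C, hC, hbound⟩ := hF.exists_pos
  obtain ⟨x₀, hx₀⟩ := eventually_atTop.1 hbound.bound
  have hp : (0 : ℝ) ≤ 1 + ε := by linarith
  -- The factor `2 ^ (1 + ε)` pays for replacing `x` by `x + 1`, valid for `x ≥ 1`.
  refine tendsto_quad_of_le (f := fun x => Real.exp x * F x) (G := majorant (1 + ε))
    (C := C * 2 ^ (1 + ε)) (x₀ := max x₀ 1) (by positivity) (summable_mass_mul_exp hsum)
    (fun n => Real.continuous_exp.continuousWithinAt.mul (hcont n))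
    (quadConverges_majorant (by linarith)) (fun x y hx hxy => majorant_mono hp hx hxy)
    fun x hx => ?_
  have hx1 : 1 ≤ x := (le_max_right _ _).trans hx
  have hb := hx₀ x ((le_max_left _ _).trans hx)
  rw [Real.norm_eq_abs, Real.norm_of_nonneg (by positivity)] at hb
  rw [abs_mul, Real.abs_exp]
  calc Real.exp x * |F x| ≤ Real.exp x * (C * (2 ^ (1 + ε) * (x + 1) ^ (-(1 + ε)))) := by
        gcongr
        exact hb.trans (mul_le_mul_of_nonneg_left (rpow_neg_le_two_rpow_mul hp hx1) hC.le)
    _ = C * 2 ^ (1 + ε) * (Real.exp x * (x + 1) ^ (-(1 + ε))) := by ring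
    _ ≤ _ := by
        gcongr
        exact exp_mul_rpow_le_majorant hp (by linarith)

end MDL

theorem mainTheorem4 :
    -- for every `N` the rule is well defined and Gaussian: `L'_N` has degree `N` and `N` distinct
    -- positive roots, the weights are positive, and the rule is exact up to degree `2N - 1`
    (∀ N : ℕ,
      (MDL.mdlPoly (Real.exp 1) N).natDegree = N ∧
      StrictMonoOn (MDL.node (Real.exp 1) N) (Set.Iio N) ∧
      (∀ k < N, (MDL.mdlPoly (Real.exp 1) N).IsRoot (MDL.node (Real.exp 1) N k) ∧
        0 < MDL.node (Real.exp 1) N k ∧ 0 < MDL.weight (Real.exp 1) N k) ∧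
      ∀ p : Polynomial ℝ, p.natDegree < 2 * N →
        ∑ k ∈ Finset.range N,
            MDL.weight (Real.exp 1) N k * p.eval (MDL.node (Real.exp 1) N k) =
          ∑' n : ℕ, MDL.mass n * p.eval (n : ℝ)) ∧
    -- the even moments of the measure
    (∀ m : ℕ, Summable (fun n : ℕ => MDL.mass n * (n : ℝ) ^ (2 * m)) ∧
      ∑' n : ℕ, MDL.mass n * (n : ℝ) ^ (2 * m) < 2 * ((2 * m).factorial : ℝ)) ∧
    -- convergence of the nodes and of the weights
    (∀ k : ℕ, Tendsto (fun N : ℕ => MDL.node (Real.exp 1) N k) atTop (𝓝 (k : ℝ)) ∧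
      Tendsto (fun N : ℕ => MDL.weight (Real.exp 1) N k) atTop (𝓝 (MDL.mass k))) ∧
    -- convergence of the rule
    (∀ (F : ℝ → ℝ) (ε : ℝ), 0 < ε →
      F =O[atTop] (fun x : ℝ => x ^ (-(1 + ε))) →
      (∀ n : ℕ, ContinuousWithinAt F (Set.Ici (n : ℝ)) (n : ℝ)) →
      Summable (fun n : ℕ => F (n : ℝ)) ∧
      Tendsto (fun N : ℕ => MDL.rule N F) atTop
        (𝓝 (MDL.primedSum fun n => F (n : ℝ)))) := by
  exact ⟨fun N => ⟨MDL.natDegree_mdlPoly N, MDL.node_strictMonoOn N,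
      fun k hk => ⟨MDL.isRoot_node hk, MDL.node_pos hk, MDL.weight_pos hk⟩,
      fun p hp => MDL.quad_eq_massFunctional hp⟩,
    fun m => ⟨MDL.summable_mass_mul_pow (2 * m), MDL.tsum_mass_mul_pow_lt (2 * m)⟩,
    fun k => ⟨MDL.tendsto_node k, MDL.tendsto_weight k⟩,
    fun F ε hε hF hcont => ⟨MDL.summable_of_isBigO_rpow hε hF, MDL.tendsto_rule hε hF hcont⟩⟩
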